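/- For a positive integer $N$ let $\mathrm{Her}(N)$ be the set of $N\times N$ complex Hermitian matrices and $\mathrm{Her}_Q(N)$ the set of those all of whose entries have rational real and imaginary parts; for $A,B\in\mathrm{Her}(N)$ write $A\leqslant B$ if $B-A$ is positive semi-definite. A function $\sigma$ that assigns to each $N\in\mathbb{N}^+$ a matrix $\sigma(N)\in\mathrm{Her}(N)$ is called a \emph{lower semicomputable semi-density matrix} if (i) $0\leqslant\sigma(N)$ and $\operatorname{tr}(\sigma(N))\le 1$ for every $N\in\mathbb{N}^+$, and (ii) there is a total recursive function $f\colon\mathbb{N}^+\times\mathbb{N}\to\bigcup_{N\ge1}\mathrm{Her}_Q(N)$ such that, for each $N\in\mathbb{N}^+$, $f(N,k)\in\mathrm{Her}_Q(N)$ and $f(N,k)\leqslant f(N,k+1)$ for all $k\in\mathbb{N}$, and $\lim_{k\to\infty}f(N,k)=\sigma(N)$. A lower semicomputable semi-density matrix $\mu$ is called a \emph{quantum universal semi-density matrix} if for every lower semicomputable semi-density matrix $\sigma$ there is a real number $c>0$ such that $c\,\sigma(N)\leqslant\mu(N)$ for all $N\in\mathbb{N}^+$. \textbf{Theorem.} If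 $\mu$ is a quantum universal semi-density matrix, then $\operatorname{tr}(\mu(N))<1$ for all but finitely many $N\in\mathbb{N}^+$. -/

import Mathlib

open scoped ComplexOrder

namespace QuantumSemiDensity

/-- The complex number `((p - p') + i (q - q')) / (d + 1)` with code `(p, p', q, q', d)`.
The numbers arising this way are exactly the complex numbers with rational real and
imaginary parts. -/
noncomputable def ofCode (c : ℕ × ℕ × ℕ × ℕ × ℕ) : ℂ :=
  (((c.1 : ℂ) - (c.2.1 : ℂ)) + ((c.2.2.1 : ℂ) - (c.2.2.2.1 : ℂ)) * Complex.I) /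
    ((c.2.2.2.2 : ℂ) + 1)

/-- A family `f (N, k)` of `N × N` matrices with entries in `ℚ + iℚ` is total recursive: there is
an algorithm which, given `N`, `k` and a position `(i, j)`, outputs (integer numerators and a
positive denominator of) the `(i, j)` entry of `f (N, k)`. As the matrices are finite and their
size `N` is part of the input, this is the same as computing the list of all entries. -/
def TotalRecursive (f : (N : ℕ+) → ℕ → Matrix (Fin N) (Fin N) ℂ) : Prop :=
  ∃ g : ℕ × ℕ × ℕ × ℕ → ℕ × ℕ × ℕ × ℕ × ℕ, Computable g ∧
    ∀ (N : ℕ+) (k : ℕ) (i j : Fin N), f N k i j = ofCode (g ((N : ℕ), k, (i : ℕ), (j : ℕ)))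

/-- The Loewner order `A ⩽ B`. -/
def LoewnerLE {n : ℕ} (A B : Matrix (Fin n) (Fin n) ℂ) : Prop :=
  (B - A).PosSemidef

/-- Lower semicomputable semi-density matrices. Positive semidefiniteness includes being
Hermitian, so that the trace is real. -/
structure IsLowerSemicomputable (σ : (N : ℕ+) → Matrix (Fin N) (Fin N) ℂ) : Prop where
  posSemidef : ∀ N : ℕ+, (σ N).PosSemidef
  trace_le_one : ∀ N : ℕ+, (σ N).trace.re ≤ 1
  exists_approx : ∃ f : (N : ℕ+) → ℕ → Matrix (Fin N) (Fin N) ℂ,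
    TotalRecursive f ∧
    ∀ N : ℕ+, Filter.Tendsto (f N) Filter.atTop (nhds (σ N)) ∧
      ∀ k : ℕ, (f N k).IsHermitian ∧ LoewnerLE (f N k) (f N (k + 1))

/-- Quantum universal semi-density matrices. -/
structure IsQuantumUniversal (μ : (N : ℕ+) → Matrix (Fin N) (Fin N) ℂ) : Prop where
  lowerSemicomputable : IsLowerSemicomputable μ
  dominates : ∀ σ : (N : ℕ+) → Matrix (Fin N) (Fin N) ℂ, IsLowerSemicomputable σ →
    ∃ c : ℝ, 0 < c ∧ ∀ N : ℕ+, LoewnerLE (c • σ N) (μ N)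

end QuantumSemiDensity

namespace QuantumSemiDensity

/-! A trace equal to 1 leaves the approximations of `μ N` too little room to grow. Run them until
the trace exceeds `1 - 1/N`. The remaining increment is positive semidefinite of trace below `1/N`,
so no diagonal entry can still gain `1/N`. At that stage some diagonal entry is at most `1/N`, by
averaging, and hence stays below `2/N` in the limit (`exists_limitIndex_of_trace_eq_one`). The
search for such an entry is effective, so the projection on the coordinate found, or zero if the
search never succeeds, is lower semicomputable (`isLowerSemicomputable_coordProj`). Universality
gives `c > 0` with `c < 2/N` whenever the trace is 1, which bounds `N`. -/

theorem ofCode_re (c : ℕ × ℕ × ℕ × ℕ × ℕ) :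
    (ofCode c).re = ((c.1 : ℝ) - c.2.1) / ((c.2.2.2.2 : ℝ) + 1) := by
  have h : ((c.2.2.2.2 : ℂ) + 1) = (((c.2.2.2.2 : ℝ) + 1 : ℝ) : ℂ) := by push_cast; rfl
  unfold ofCode
  rw [h, Complex.div_ofReal_re]
  simp

/-! ### Exact arithmetic on codes -/

/-- One step of the summation of fractions `(a - b) / D`, coded by `(a, b, D)`: adds the real part
of `ofCode c`. -/
def addCode (s : ℕ × ℕ × ℕ) (c : ℕ × ℕ × ℕ × ℕ × ℕ) : ℕ × ℕ × ℕ :=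
  (s.1 * (c.2.2.2.2 + 1) + c.1 * s.2.2, s.2.1 * (c.2.2.2.2 + 1) + c.2.1 * s.2.2,
    s.2.2 * (c.2.2.2.2 + 1))

/-- A fraction, coded as for `addCode`, for the sum of the real parts of `ofCode (d i)`, `i < n`. -/
def sumCode (d : ℕ → ℕ × ℕ × ℕ × ℕ × ℕ) (n : ℕ) : ℕ × ℕ × ℕ :=
  Nat.rec (0, 0, 1) (fun i s => addCode s (d i)) n

theorem sumCode_spec (d : ℕ → ℕ × ℕ × ℕ × ℕ × ℕ) (n : ℕ) :
    0 < (sumCode d n).2.2 ∧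
      ∑ i ∈ Finset.range n, (ofCode (d i)).re =
        (((sumCode d n).1 : ℝ) - (sumCode d n).2.1) / (sumCode d n).2.2 := by
  induction n with
  | zero => simp [sumCode]
  | succ n ih =>
    obtain ⟨hpos, hsum⟩ := ih
    have hstep : sumCode d (n + 1) = addCode (sumCode d n) (d n) := rfl
    rw [hstep, Finset.sum_range_succ, hsum, ofCode_re]
    have h0 : ((sumCode d n).2.2 : ℝ) ≠ 0 := by exact_mod_cast hpos.ne'
    have h1 : (((d n).2.2.2.2 : ℝ) + 1) ≠ 0 := by positivity
    refine ⟨by simp only [addCode]; positivity, ?_⟩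
    simp only [addCode]
    push_cast
    field_simp
    ring

/-- The test, on codes `d` of the diagonal entries of an `N × N` matrix, that its trace exceeds
`1 - 1 / N` and that its `i`-th diagonal entry is at most `1 / N`. -/
def smallEntryTest (N : ℕ) (d : ℕ → ℕ × ℕ × ℕ × ℕ × ℕ) (i : ℕ) : Prop :=
  (i < N ∧ N * (sumCode d N).2.2 + N * (sumCode d N).2.1 <
      N * (sumCode d N).1 + (sumCode d N).2.2) ∧
    N * (d i).1 ≤ N * (d i).2.1 + ((d i).2.2.2.2 + 1)

instance (N : ℕ) (d : ℕ → ℕ × ℕ × ℕ × ℕ × ℕ) (i : ℕ) : Decidable (smallEntryTest N d i) :=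
  inferInstanceAs (Decidable (_ ∧ _))

/-- Clearing denominators and moving subtracted terms across turns the real inequalities into
inequalities of naturals, which can be decided. -/
theorem smallEntryTest_iff {N : ℕ} (hN : 0 < N) (d : ℕ → ℕ × ℕ × ℕ × ℕ × ℕ) (i : ℕ) :
    smallEntryTest N d i ↔
      (i < N ∧ 1 - 1 / (N : ℝ) < ∑ i ∈ Finset.range N, (ofCode (d i)).re) ∧
        (ofCode (d i)).re ≤ 1 / N := by
  obtain ⟨hpos, hsum⟩ := sumCode_spec d N
  have hN' : (0 : ℝ) < N := by exact_mod_cast hN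
  have hD : (0 : ℝ) < (sumCode d N).2.2 := by exact_mod_cast hpos
  have hd : (0 : ℝ) < (d i).2.2.2.2 + 1 := by positivity
  have e : 1 - 1 / (N : ℝ) = (N - 1) / N := by field_simp
  rw [hsum, ofCode_re, e, div_lt_div_iff₀ hN' hD, div_le_div_iff₀ hd hN', smallEntryTest]
  refine and_congr (and_congr Iff.rfl ?_) ?_
  · rw [← Nat.cast_lt (α := ℝ)]
    push_cast
    constructor <;> intro h <;> linarith
  · rw [← Nat.cast_le (α := ℝ)]
    push_cast
    constructor <;> intro h <;> linarith

/-! ### The search and its computability -/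

/-- The codes of the diagonal entries of the matrix number `k` in dimension `N`. -/
def diagCode (g : ℕ × ℕ × ℕ × ℕ → ℕ × ℕ × ℕ × ℕ × ℕ) (N k i : ℕ) : ℕ × ℕ × ℕ × ℕ × ℕ :=
  g (N, k, i, i)

/-- The index found by testing the pairs (matrix number, index) with codes below `k`, keeping the
first success. -/
def firstIndex (g : ℕ × ℕ × ℕ × ℕ → ℕ × ℕ × ℕ × ℕ × ℕ) (N k : ℕ) : Option ℕ :=
  Nat.rec none (fun m o => o <|>
    if smallEntryTest N (diagCode g N m.unpair.1) m.unpair.2 then some m.unpair.2 else none) k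

theorem primrec_addCode : Primrec₂ addCode := by
  unfold addCode
  have s1 : Primrec fun p : (ℕ × ℕ × ℕ) × (ℕ × ℕ × ℕ × ℕ × ℕ) => p.1.1 :=
    Primrec.fst.comp Primrec.fst
  have s2 : Primrec fun p : (ℕ × ℕ × ℕ) × (ℕ × ℕ × ℕ × ℕ × ℕ) => p.1.2.1 :=
    Primrec.fst.comp (Primrec.snd.comp Primrec.fst)
  have s3 : Primrec fun p : (ℕ × ℕ × ℕ) × (ℕ × ℕ × ℕ × ℕ × ℕ) => p.1.2.2 :=
    Primrec.snd.comp (Primrec.snd.comp Primrec.fst)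
  have c1 : Primrec fun p : (ℕ × ℕ × ℕ) × (ℕ × ℕ × ℕ × ℕ × ℕ) => p.2.1 :=
    Primrec.fst.comp Primrec.snd
  have c2 : Primrec fun p : (ℕ × ℕ × ℕ) × (ℕ × ℕ × ℕ × ℕ × ℕ) => p.2.2.1 :=
    Primrec.fst.comp (Primrec.snd.comp Primrec.snd)
  have c5 : Primrec fun p : (ℕ × ℕ × ℕ) × (ℕ × ℕ × ℕ × ℕ × ℕ) => p.2.2.2.2.2 + 1 :=
    Primrec.succ.comp (Primrec.snd.comp (Primrec.snd.comp (Primrec.snd.comp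
      (Primrec.snd.comp Primrec.snd))))
  exact Primrec.pair
    (Primrec.nat_add.comp (Primrec.nat_mul.comp s1 c5) (Primrec.nat_mul.comp c1 s3))
    (Primrec.pair
      (Primrec.nat_add.comp (Primrec.nat_mul.comp s2 c5) (Primrec.nat_mul.comp c2 s3))
      (Primrec.nat_mul.comp s3 c5))

theorem computable_diagCode {g : ℕ × ℕ × ℕ × ℕ → ℕ × ℕ × ℕ × ℕ × ℕ} (hg : Computable g)
    {α : Type*} [Primcodable α] {N k i : α → ℕ} (hN : Computable N) (hk : Computable k)
    (hi : Computable i) : Computable fun a => diagCode g (N a) (k a) (i a) :=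
  hg.comp (hN.pair (hk.pair (hi.pair hi)))

theorem computable_sumCode {g : ℕ × ℕ × ℕ × ℕ → ℕ × ℕ × ℕ × ℕ × ℕ} (hg : Computable g)
    {α : Type*} [Primcodable α] {N k : α → ℕ} (hN : Computable N) (hk : Computable k) :
    Computable fun a => sumCode (diagCode g (N a) (k a)) (N a) := by
  unfold sumCode
  refine Computable.nat_rec (σ := ℕ × ℕ × ℕ)
    (h := fun a p => addCode p.2 (diagCode g (N a) (k a) p.1)) hN (Computable.const (0, 0, 1)) ?_
  refine (Primrec₂.to_comp primrec_addCode).comp (Computable.snd.comp Computable.snd) ?_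
  exact computable_diagCode hg (hN.comp Computable.fst) (hk.comp Computable.fst)
    (Computable.fst.comp Computable.snd)

theorem computable_smallEntryTest {g : ℕ × ℕ × ℕ × ℕ → ℕ × ℕ × ℕ × ℕ × ℕ} (hg : Computable g)
    {α : Type*} [Primcodable α] {N k i : α → ℕ} (hN : Computable N) (hk : Computable k)
    (hi : Computable i) :
    Computable fun a => decide (smallEntryTest (N a) (diagCode g (N a) (k a)) (i a)) := by
  have hS := computable_sumCode hg hN hk
  have hd := computable_diagCode hg hN hk hi
  have add {u v : α → ℕ} (hu : Computable u) (hv : Computable v) :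
      Computable fun a => u a + v a := (Primrec₂.to_comp Primrec.nat_add).comp hu hv
  have mul {u v : α → ℕ} (hu : Computable u) (hv : Computable v) :
      Computable fun a => u a * v a := (Primrec₂.to_comp Primrec.nat_mul).comp hu hv
  have lt {u v : α → ℕ} (hu : Computable u) (hv : Computable v) :
      Computable fun a => decide (u a < v a) :=
    (Primrec₂.to_comp (Primrec.nat_lt.decide)).comp hu hv
  have le {u v : α → ℕ} (hu : Computable u) (hv : Computable v) :
      Computable fun a => decide (u a ≤ v a) :=
    (Primrec₂.to_comp (Primrec.nat_le.decide)).comp hu hv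
  have and {u v : α → Bool} (hu : Computable u) (hv : Computable v) :
      Computable fun a => u a && v a := (Primrec₂.to_comp Primrec.and).comp hu hv
  have S1 := Computable.fst.comp hS
  have S2 := Computable.fst.comp (Computable.snd.comp hS)
  have S3 := Computable.snd.comp (Computable.snd.comp hS)
  have d1 := Computable.fst.comp hd
  have d2 := Computable.fst.comp (Computable.snd.comp hd)
  have d5 := Computable.succ.comp (Computable.snd.comp (Computable.snd.comp
    (Computable.snd.comp (Computable.snd.comp hd))))
  refine (and (and (lt hi hN) (lt (add (mul hN S3) (mul hN S2)) (add (mul hN S1) S3)))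
    (le (mul hN d1) (add (mul hN d2) d5))).of_eq fun a => ?_
  rw [Bool.eq_iff_iff, decide_eq_true_iff]
  simp only [smallEntryTest, Bool.and_eq_true, decide_eq_true_eq, Nat.succ_eq_add_one]

theorem computable_firstIndex {g : ℕ × ℕ × ℕ × ℕ → ℕ × ℕ × ℕ × ℕ × ℕ} (hg : Computable g)
    {α : Type*} [Primcodable α] {N k : α → ℕ} (hN : Computable N) (hk : Computable k) :
    Computable fun a => firstIndex g (N a) (k a) := by
  unfold firstIndex
  refine Computable.nat_rec (σ := Option ℕ) (h := fun a q => q.2 <|>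
    if smallEntryTest (N a) (diagCode g (N a) q.1.unpair.1) q.1.unpair.2 then some q.1.unpair.2
    else none) hk (Computable.const none) ?_
  have hm : Computable fun p : α × ℕ × Option ℕ => p.2.1.unpair :=
    Computable.unpair.comp (Computable.fst.comp Computable.snd)
  have hN' : Computable fun p : α × ℕ × Option ℕ => N p.1 := hN.comp Computable.fst
  have h2 := Computable.snd.comp hm
  refine (Primrec₂.to_comp Primrec.option_orElse).comp (Computable.snd.comp Computable.snd) ?_
  refine (Computable.cond (computable_smallEntryTest hg hN' (Computable.fst.comp hm) h2)
    (Computable.option_some.comp h2) (Computable.const none)).of_eq fun p => ?_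
  by_cases h : smallEntryTest (N p.1) (diagCode g (N p.1) p.2.1.unpair.1) p.2.1.unpair.2 <;>
    simp [h]

/-! ### Stabilisation of the search -/

theorem firstIndex_succ (g : ℕ × ℕ × ℕ × ℕ → ℕ × ℕ × ℕ × ℕ × ℕ) (N k : ℕ) :
    firstIndex g N (k + 1) = (firstIndex g N k <|>
      if smallEntryTest N (diagCode g N k.unpair.1) k.unpair.2 then some k.unpair.2 else none) :=
  rfl

theorem firstIndex_stable {g : ℕ × ℕ × ℕ × ℕ → ℕ × ℕ × ℕ × ℕ × ℕ} {N k i : ℕ}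
    (h : firstIndex g N k = some i) {l : ℕ} (hl : k ≤ l) : firstIndex g N l = some i := by
  induction l, hl using Nat.le_induction with
  | base => exact h
  | succ l _ ih => rw [firstIndex_succ, ih]; rfl

theorem exists_test_of_firstIndex {g : ℕ × ℕ × ℕ × ℕ → ℕ × ℕ × ℕ × ℕ × ℕ} {N k i : ℕ}
    (h : firstIndex g N k = some i) : ∃ m, smallEntryTest N (diagCode g N m) i := by
  induction k with
  | zero => cases h
  | succ k ih =>
    rw [firstIndex_succ] at h
    cases h' : firstIndex g N k with
    | some j =>
      rw [h'] at h
      exact ih (h'.trans h)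
    | none =>
      rw [h'] at h
      by_cases ht : smallEntryTest N (diagCode g N k.unpair.1) k.unpair.2
      · simp [ht] at h
        exact ⟨_, h ▸ ht⟩
      · simp [ht] at h

theorem exists_firstIndex_of_test {g : ℕ × ℕ × ℕ × ℕ → ℕ × ℕ × ℕ × ℕ × ℕ} {N m i : ℕ}
    (h : smallEntryTest N (diagCode g N m) i) : ∃ k j, firstIndex g N k = some j := by
  refine ⟨Nat.pair m i + 1, ?_⟩
  rw [firstIndex_succ]
  cases firstIndex g N (Nat.pair m i) with
  | some j => exact ⟨j, rfl⟩
  | none => exact ⟨i, by simp [h]⟩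

open Classical in
/-- The eventual value of `firstIndex g N`. -/
noncomputable def limitIndex (g : ℕ × ℕ × ℕ × ℕ → ℕ × ℕ × ℕ × ℕ × ℕ) (N : ℕ) : Option ℕ :=
  if h : ∃ k j, firstIndex g N k = some j then firstIndex g N h.choose else none

theorem firstIndex_eq_limitIndex {g : ℕ × ℕ × ℕ × ℕ → ℕ × ℕ × ℕ × ℕ × ℕ} {N k i : ℕ}
    (h : firstIndex g N k = some i) : limitIndex g N = some i := by
  have hex : ∃ k j, firstIndex g N k = some j := ⟨k, i, h⟩
  rw [limitIndex, dif_pos hex]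
  obtain ⟨j, hj⟩ := hex.choose_spec
  have h1 := firstIndex_stable hj (le_max_left hex.choose k)
  have h2 := firstIndex_stable h (le_max_right hex.choose k)
  rw [hj, ← h1, h2]

theorem firstIndex_eventually_eq (g : ℕ × ℕ × ℕ × ℕ → ℕ × ℕ × ℕ × ℕ × ℕ) (N : ℕ) :
    ∀ᶠ k in Filter.atTop, firstIndex g N k = limitIndex g N := by
  by_cases hex : ∃ k j, firstIndex g N k = some j
  · obtain ⟨k, j, h⟩ := hex
    filter_upwards [Filter.eventually_ge_atTop k] with l hl
    rw [firstIndex_stable h hl, firstIndex_eq_limitIndex h]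
  · refine Filter.Eventually.of_forall fun k => ?_
    rw [limitIndex, dif_neg hex]
    push Not at hex
    exact Option.eq_none_iff_forall_ne_some.2 (hex k)

/-! ### The competing semi-density matrix -/

/-- The projection on the coordinate `o`, or zero if `o` is not the index of a coordinate. -/
noncomputable def coordProj (n : ℕ) (o : Option ℕ) : Matrix (Fin n) (Fin n) ℂ :=
  Matrix.diagonal fun i => if o = some (i : ℕ) then 1 else 0

theorem coordProj_none (n : ℕ) : coordProj n none = 0 := by
  simp [coordProj]

theorem coordProj_posSemidef (n : ℕ) (o : Option ℕ) : (coordProj n o).PosSemidef := by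
  refine Matrix.PosSemidef.diagonal fun i => ?_
  dsimp only [Pi.zero_apply]
  split_ifs <;> simp

theorem coordProj_trace_le_one (n : ℕ) (o : Option ℕ) : (coordProj n o).trace.re ≤ 1 := by
  rw [coordProj, Matrix.trace_diagonal, Finset.sum_boole, Complex.natCast_re]
  exact_mod_cast Finset.card_le_one.2 fun a ha b hb => by
    simp only [Finset.mem_filter, Finset.mem_univ, true_and] at ha hb
    exact Fin.ext (Option.some.inj (ha.symm.trans hb))

/-- The stages are zero until the search succeeds and one fixed projection afterwards, so they
increase. Only the stages need be computable, not `limitIndex`. -/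
theorem isLowerSemicomputable_coordProj {g : ℕ × ℕ × ℕ × ℕ → ℕ × ℕ × ℕ × ℕ × ℕ}
    (hg : Computable g) :
    IsLowerSemicomputable fun N : ℕ+ => coordProj N (limitIndex g N) where
  posSemidef N := coordProj_posSemidef _ _
  trace_le_one N := coordProj_trace_le_one _ _
  exists_approx := by
    refine ⟨fun N k => coordProj N (firstIndex g N k), ?_, fun N => ⟨?_, fun k => ⟨?_, ?_⟩⟩⟩
    · refine ⟨fun p => cond (decide (p.2.2.1 = p.2.2.2) &&
        decide (firstIndex g p.1 p.2.1 = some p.2.2.1)) (1, 0, 0, 0, 0) (0, 0, 0, 0, 0), ?_, ?_⟩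
      · have c1 : Computable fun p : ℕ × ℕ × ℕ × ℕ => p.1 := Computable.fst
        have c2 : Computable fun p : ℕ × ℕ × ℕ × ℕ => p.2.1 := Computable.fst.comp Computable.snd
        have c3 : Computable fun p : ℕ × ℕ × ℕ × ℕ => p.2.2.1 :=
          Computable.fst.comp (Computable.snd.comp Computable.snd)
        have c4 : Computable fun p : ℕ × ℕ × ℕ × ℕ => p.2.2.2 :=
          Computable.snd.comp (Computable.snd.comp Computable.snd)
        have e1 : Computable fun p : ℕ × ℕ × ℕ × ℕ => decide (p.2.2.1 = p.2.2.2) :=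
          (Primrec₂.to_comp (Primrec.eq (α := ℕ)).decide).comp c3 c4
        have hF : Computable fun p : ℕ × ℕ × ℕ × ℕ => firstIndex g p.1 p.2.1 :=
          computable_firstIndex hg c1 c2
        have e2 : Computable fun p : ℕ × ℕ × ℕ × ℕ =>
            decide (firstIndex g p.1 p.2.1 = some p.2.2.1) :=
          (Primrec₂.to_comp (Primrec.eq (α := Option ℕ)).decide).comp hF
            (Computable.option_some.comp c3)
        exact Computable.cond ((Primrec₂.to_comp Primrec.and).comp e1 e2)
          (Computable.const _) (Computable.const _)
      · intro N k i j
        by_cases hij : i = j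
        · subst hij
          by_cases h : firstIndex g N k = some (i : ℕ) <;> simp [coordProj, ofCode, h]
        · have hij' : (i : ℕ) ≠ j := fun h => hij (Fin.ext h)
          simp [coordProj, ofCode, hij, hij']
    · refine tendsto_const_nhds.congr' ?_
      filter_upwards [firstIndex_eventually_eq g N] with k hk
      rw [hk]
    · exact (coordProj_posSemidef _ _).isHermitian
    · unfold LoewnerLE
      beta_reduce
      cases h : firstIndex g N k with
      | none => rw [coordProj_none, sub_zero]; exact coordProj_posSemidef _ _
      | some i =>
        rw [firstIndex_stable h (Nat.le_add_right k 1), sub_self]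
        exact Matrix.PosSemidef.zero

/-! ### Diagonal entries and the final bound -/

theorem LoewnerLE.diag_re_le {n : ℕ} {A B : Matrix (Fin n) (Fin n) ℂ} (h : LoewnerLE A B)
    (i : Fin n) : (A i i).re ≤ (B i i).re := by
  have := (Complex.le_def.1 (Matrix.PosSemidef.diag_nonneg (i := i) h)).1
  simpa using this

theorem trace_re_eq_sum {n : ℕ} (A : Matrix (Fin n) (Fin n) ℂ) :
    A.trace.re = ∑ i, (A i i).re := by
  simp [Matrix.trace]

theorem diag_re_le_of_tendsto {n : ℕ} {f : ℕ → Matrix (Fin n) (Fin n) ℂ}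
    {A : Matrix (Fin n) (Fin n) ℂ} (hf : Filter.Tendsto f Filter.atTop (nhds A))
    (hmono : ∀ k, LoewnerLE (f k) (f (k + 1))) (k : ℕ) (i : Fin n) :
    (f k i i).re ≤ (A i i).re := by
  have hm : Monotone fun k => (f k i i).re :=
    monotone_nat_of_le_succ fun k => (hmono k).diag_re_le i
  have hc : Continuous fun M : Matrix (Fin n) (Fin n) ℂ => (M i i).re := by fun_prop
  exact hm.ge_of_tendsto ((hc.tendsto A).comp hf) k

/-- If the trace of the limit `A` is `1`, the search succeeds, and finds a diagonal entry of `A` that is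
less than `2 / n`. -/
theorem exists_limitIndex_of_trace_eq_one {n : ℕ} (hn : 0 < n)
    {g : ℕ × ℕ × ℕ × ℕ → ℕ × ℕ × ℕ × ℕ × ℕ}
    {f : ℕ → Matrix (Fin n) (Fin n) ℂ} {A : Matrix (Fin n) (Fin n) ℂ}
    (hfg : ∀ k (i j : Fin n), f k i j = ofCode (g (n, k, i, j)))
    (hf : Filter.Tendsto f Filter.atTop (nhds A))
    (hmono : ∀ k, LoewnerLE (f k) (f (k + 1))) (hA : A.trace.re = 1) :
    ∃ i : Fin n, limitIndex g n = some (i : ℕ) ∧ (A i i).re < 2 / n := by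
  have hn' : (0 : ℝ) < n := by exact_mod_cast hn
  have hle := diag_re_le_of_tendsto hf hmono
  have hsum (k : ℕ) : ∑ i ∈ Finset.range n, (ofCode (diagCode g n k i)).re = (f k).trace.re := by
    rw [trace_re_eq_sum, Finset.sum_range]
    exact Finset.sum_congr rfl fun i _ => by rw [hfg]; rfl
  have hex : ∃ m i, smallEntryTest n (diagCode g n m) i := by
    have hc : Continuous fun M : Matrix (Fin n) (Fin n) ℂ => M.trace.re := by fun_prop
    have ht := (hc.tendsto A).comp hf
    have hlt : 1 - 1 / (n : ℝ) < A.trace.re := by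
      rw [hA]; have : 0 < 1 / (n : ℝ) := by positivity
      linarith
    obtain ⟨m, hm⟩ := (ht.eventually (lt_mem_nhds hlt)).exists
    have hm' : 1 - 1 / (n : ℝ) < (f m).trace.re := hm
    have hne : (Finset.univ : Finset (Fin n)).Nonempty := ⟨⟨0, hn⟩, Finset.mem_univ _⟩
    -- Averaging: the `n` diagonal entries of `f m` sum to at most 1.
    obtain ⟨i, -, hi⟩ : ∃ i ∈ Finset.univ, (f m i i).re ≤ 1 / (n : ℝ) := by
      refine Finset.exists_le_of_sum_le hne ?_
      calc ∑ i, (f m i i).re ≤ ∑ i, (A i i).re := Finset.sum_le_sum fun i _ => hle m i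
        _ = 1 := by rw [← trace_re_eq_sum, hA]
        _ = ∑ _i : Fin n, 1 / (n : ℝ) := by
          rw [Finset.sum_const, Finset.card_univ, Fintype.card_fin, nsmul_eq_mul]
          field_simp
    refine ⟨m, i, (smallEntryTest_iff hn _ _).2 ⟨⟨i.2, by rwa [hsum]⟩, ?_⟩⟩
    rw [hfg] at hi
    exact hi
  -- The search may stop at another pair `(l, j)`, so the bounds are read off from the test passed
  -- there.
  obtain ⟨m, i, hmi⟩ := hex
  obtain ⟨k, j, hk⟩ := exists_firstIndex_of_test hmi
  obtain ⟨l, hl⟩ := exists_test_of_firstIndex hk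
  obtain ⟨⟨hj, htr⟩, hsmall⟩ := (smallEntryTest_iff hn _ _).1 hl
  refine ⟨⟨j, hj⟩, firstIndex_eq_limitIndex hk, ?_⟩
  set j' : Fin n := ⟨j, hj⟩
  have h1 : (f l j' j').re ≤ 1 / n := by rw [hfg]; exact hsmall
  -- All diagonal increments are nonnegative, so each is at most their sum.
  have h2 : (A j' j').re - (f l j' j').re ≤ A.trace.re - (f l).trace.re := by
    rw [trace_re_eq_sum, trace_re_eq_sum, ← Finset.sum_sub_distrib]
    exact Finset.single_le_sum (f := fun i => (A i i).re - (f l i i).re)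
      (fun i _ => sub_nonneg.2 (hle l i)) (Finset.mem_univ j')
  rw [hsum] at htr
  have h3 : (2 : ℝ) / n = 1 / n + 1 / n := by ring
  rw [h3]
  linarith

end QuantumSemiDensity

open QuantumSemiDensity in
theorem mainTheorem11 (μ : (N : ℕ+) → Matrix (Fin N) (Fin N) ℂ)
    (hμ : QuantumSemiDensity.IsQuantumUniversal μ) :
    {N : ℕ+ | ¬ (μ N).trace.re < 1}.Finite := by
  obtain ⟨f, ⟨g, hg, hfg⟩, hf⟩ := hμ.lowerSemicomputable.exists_approx
  obtain ⟨c, hc, hdom⟩ := hμ.dominates _ (isLowerSemicomputable_coordProj hg)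
  obtain ⟨M, hM⟩ := exists_nat_gt (2 / c)
  refine (Set.finite_Iic (M.succPNat)).subset fun N hN => ?_
  have htr : (μ N).trace.re = 1 :=
    le_antisymm (hμ.lowerSemicomputable.trace_le_one N) (not_lt.1 hN)
  obtain ⟨i, hi, hlt⟩ := exists_limitIndex_of_trace_eq_one N.pos (hfg N) (hf N).1
    (fun k => ((hf N).2 k).2) htr
  have hle := (hdom N).diag_re_le i
  simp only [coordProj, hi, Matrix.smul_apply, Matrix.diagonal_apply_eq, if_true,
    Complex.smul_re, Complex.one_re, smul_eq_mul, mul_one] at hle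
  have hN0 : (0 : ℝ) < (N : ℕ) := by exact_mod_cast N.pos
  have h1 : c < 2 / (N : ℕ) := hle.trans_lt hlt
  have h2 : ((N : ℕ) : ℝ) < 2 / c := by
    rw [lt_div_iff₀ hN0] at h1
    rw [lt_div_iff₀ hc]
    linarith
  have h3 : (N : ℕ) < M := by exact_mod_cast h2.trans hM
  exact (PNat.coe_le_coe _ _).1 (by rw [Nat.succPNat_coe]; omega)
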